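/- Let $0<s<1$, $G_s=\{z\in\mathbb C: s<|z|<1\}$ and $\partial G_s=s\mathbb T\cup\mathbb T$, where $\mathbb T$ is the unit circle; let $\mu$ be the Lebesgue measure on $\partial G_s$, normalized so that $\mathbb T$ and $s\mathbb T$ each have measure $1$. Let $H^\infty(G_s)$ be the space of bounded analytic functions on $G_s$; such a function has boundary values (radial limits) almost everywhere on $\partial G_s$, which are denoted by the same letter. For an integer $k\ge 0$ let $H^{k,\infty}(\partial G_s)=H^{k,\infty}(G_s)$ be the space of all $f\in H^\infty(G_s)$ whose complex derivatives $f^{(i)}$, $0\le i\le k$, all lie in $H^\infty(G_s)$, with the norm $$\|f\|_{H^{k,\infty}(\partial G_s)}=\max_{0\le i\le k}\left(\|f^{(i)}\|_{L^\infty(s\mathbb T)}+\|f^{(i)}\|_{L^\infty(\mathbb T)}\right).$$ For a nonempty, connected, relatively open set $I\subset\partial G_s$ put $\|f\|_{L^1(I)}=\frac1{\mu(I)}\int_I|f|\,d\mu$. Let $j,k$ be integers with $0\le j<k$, let $I\subset\partial G_s$ be nonempty, connected and relatively open, and let $(f_p)_{p\in\mathbb N}$ be a sequence in the closed unit ball of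 $H^{k,\infty}(\partial G_s)$ such that $\|f_p\|_{L^1(I)}\to 0$ as $p\to\infty$. Then $\|f_p\|_{H^{j,\infty}(\partial G_s)}\to 0$ as $p\to\infty$. -/

import Mathlib

open Filter Topology MeasureTheory
open scoped ENNReal

noncomputable section

/-- The open annulus `G_s = {z : s < |z| < 1}`. -/
def annulus (s : ℝ) : Set ℂ := {z | s < ‖z‖ ∧ ‖z‖ < 1}

/-- The boundary `∂G_s = s𝕋 ∪ 𝕋` of the annulus (for `0 < s < 1`). -/
def annulusBoundary (s : ℝ) : Set ℂ := Metric.sphere 0 s ∪ Metric.sphere 0 1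

/-- Lebesgue measure `dθ / 2π` on the circle `r𝕋`, of total mass one, as a measure on `ℂ`. -/
def circleMeasure (r : ℝ) : Measure ℂ :=
  ENNReal.ofReal (2 * Real.pi)⁻¹ •
    Measure.map (fun θ : ℝ => (r : ℂ) * Complex.exp (θ * Complex.I))
      (volume.restrict (Set.Ioc 0 (2 * Real.pi)))

/-- The measure `μ` on `∂G_s`, for which `𝕋` and `s𝕋` each have unit measure. -/
def boundaryMeasure (s : ℝ) : Measure ℂ := circleMeasure s + circleMeasure 1

/-- The boundary value of a function `g` on `G_s` at a point `z ∈ ∂G_s`: the radial limit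
`lim g (ρ z / |z|)` as `ρ → |z|`, `s < ρ < 1`. For bounded analytic `g` it exists at almost every
boundary point. -/
def boundaryValue (s : ℝ) (g : ℂ → ℂ) (z : ℂ) : ℂ :=
  limUnder (𝓝[Set.Ioo s 1] ‖z‖) (fun ρ : ℝ => g ((ρ : ℂ) * (z / (‖z‖ : ℂ))))

/-- `g ∈ H^∞(G_s)`: bounded and analytic on the annulus (only the values on `G_s` matter). -/
def MemHInfty (s : ℝ) (g : ℂ → ℂ) : Prop :=
  DifferentiableOn ℂ g (annulus s) ∧ ∃ M : ℝ, ∀ z ∈ annulus s, ‖g z‖ ≤ M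

/-- `f ∈ H^{k,∞}(G_s)`: the complex derivatives `f^{(j)}`, `0 ≤ j ≤ k`, are in `H^∞(G_s)`. -/
def MemHardySobolev (s : ℝ) (k : ℕ) (f : ℂ → ℂ) : Prop :=
  ∀ j ≤ k, MemHInfty s (iteratedDeriv j f)

/-- `‖g‖_{L^∞(r𝕋)}`, for `r = s` or `r = 1`: the essential supremum of the boundary values. -/
def linftyCircleNorm (s r : ℝ) (g : ℂ → ℂ) : ℝ≥0∞ :=
  eLpNorm (boundaryValue s g) ∞ (circleMeasure r)

/-- `‖f‖_{H^{k,∞}} = max_{0 ≤ j ≤ k} (‖f^{(j)}‖_{L^∞(s𝕋)} + ‖f^{(j)}‖_{L^∞(𝕋)})`. -/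
def hardySobolevNorm (s : ℝ) (k : ℕ) (f : ℂ → ℂ) : ℝ≥0∞ :=
  (Finset.range (k + 1)).sup fun j =>
    linftyCircleNorm s s (iteratedDeriv j f) + linftyCircleNorm s 1 (iteratedDeriv j f)

/-- The closed unit ball of `H^{k,∞}(∂G_s)`. -/
def hardySobolevUnitBall (s : ℝ) (k : ℕ) : Set (ℂ → ℂ) :=
  {f | MemHardySobolev s k f ∧ hardySobolevNorm s k f ≤ 1}

/-- `‖f‖_{L^1(I)} = μ(I)⁻¹ ∫_I |f| dμ`, the normalized `L^1` norm of the boundary values on `I`. -/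
def l1ArcNorm (s : ℝ) (I : Set ℂ) (f : ℂ → ℂ) : ℝ≥0∞ :=
  (boundaryMeasure s I)⁻¹ * ∫⁻ z in I, ‖boundaryValue s f z‖ₑ ∂(boundaryMeasure s)

/-- `I` is a (nonempty) connected, relatively open subset of `∂G_s`. -/
def IsOpenBoundaryArc (s : ℝ) (I : Set ℂ) : Prop :=
  IsConnected I ∧ ∃ U : Set ℂ, IsOpen U ∧ I = U ∩ annulusBoundary s

end

/-! Pull each derivative of order `i < k` back by `exp` to the strip `log s < Re w < 0`. Once the
next derivative is known to be bounded by `s⁻¹` on the annulus, these lifts extend to Lipschitz maps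
of `ℂ` with a constant independent of `p`. Smallness in `L¹` of the arc then becomes pointwise
convergence on a boundary segment. A limit along an ultrafilter is holomorphic in the strip and zero
on that segment, hence zero (`tendsto_zero_of_boundary_segment`). Cauchy's estimate passes the
convergence to higher derivatives, and the common Lipschitz constant makes it uniform on a compact
rectangle covering both circles.

The delicate point is the interior bound, since the norm sees only radial limits
(`norm_deriv_le_of_linftyCircleNorm_le`). The lift is Lipschitz, so its restriction to a boundary
line is differentiable almost everywhere, and at such points the radial limit of the derivative
exists and is read off from the tangential one (`tendsto_deriv_of_lipschitzWith`). The norm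
therefore bounds the boundary speed, and Phragmén–Lindelöf applied to vertical increments carries
this bound inside. -/

/-! ### Boundary behaviour of Lipschitz holomorphic functions on a strip -/

/-- A function holomorphic on a square, bounded by `B` there and by `ε` on the right edge, satisfies
`‖H c‖ ^ 4 ≤ ε * B ^ 3` at the centre. -/
theorem norm_center_pow_four_le {H : ℂ → ℂ} {c : ℂ} {q B ε : ℝ} (hq : 0 < q)
    (hc : Continuous H)
    (hd : ∀ w : ℂ, |w.re - c.re| < q → |w.im - c.im| < q → DifferentiableAt ℂ H w)
    (hB : ∀ w : ℂ, |w.re - c.re| ≤ q → |w.im - c.im| ≤ q → ‖H w‖ ≤ B)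
    (hε : ∀ w : ℂ, w.re = c.re + q → |w.im - c.im| ≤ q → ‖H w‖ ≤ ε) :
    ‖H c‖ ^ 4 ≤ ε * B ^ 3 := by
  set U : Set ℂ := Set.Ioo (-q) q ×ℂ Set.Ioo (-q) q with hU
  have hB0 : 0 ≤ B := (norm_nonneg _).trans (hB c (by simpa using hq.le) (by simpa using hq.le))
  have hε0 : 0 ≤ ε := (norm_nonneg _).trans
    (hε ⟨c.re + q, c.im⟩ rfl (by simpa using hq.le))
  -- Product over the four quarter turns about `c`: on each edge of the square one factor is
  -- evaluated on the right edge, and at the centre the product is `H c ^ 4`.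
  let P : ℂ → ℂ := fun u => H (c + u) * H (c + Complex.I * u) * H (c - u) * H (c - Complex.I * u)
  have hclos : closure U = Set.Icc (-q) q ×ℂ Set.Icc (-q) q := by
    rw [hU, Complex.closure_reProdIm, closure_Ioo (by linarith)]
  have hopen : IsOpen U := isOpen_Ioo.reProdIm isOpen_Ioo
  have hbdd : Bornology.IsBounded U :=
    (Metric.isBounded_Ioo _ _).reProdIm (Metric.isBounded_Ioo _ _)
  have hP : DiffContOnCl ℂ P U := by
    refine ⟨fun u hu => ?_, by fun_prop⟩
    obtain ⟨h1, h2⟩ := hu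
    have h1' : |u.re| < q := abs_lt.2 h1
    have h2' : |u.im| < q := abs_lt.2 h2
    have e1 : DifferentiableAt ℂ (fun u => H (c + u)) u :=
      (hd (c + u) (by simpa using h1') (by simpa using h2')).comp u (by fun_prop)
    have e2 : DifferentiableAt ℂ (fun u => H (c + Complex.I * u)) u :=
      (hd (c + Complex.I * u) (by simpa using h2') (by simpa using h1')).comp u (by fun_prop)
    have e3 : DifferentiableAt ℂ (fun u => H (c - u)) u :=
      (hd (c - u) (by simpa using h1') (by simpa using h2')).comp u (by fun_prop)
    have e4 : DifferentiableAt ℂ (fun u => H (c - Complex.I * u)) u :=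
      (hd (c - Complex.I * u) (by simpa using h2') (by simpa using h1')).comp u (by fun_prop)
    exact (((e1.mul e2).mul e3).mul e4).differentiableWithinAt
  have key : ∀ u ∈ frontier U, ‖P u‖ ≤ ε * B ^ 3 := by
    intro u hu
    rw [frontier, hclos, hopen.interior_eq] at hu
    obtain ⟨⟨⟨h1, h2⟩, h3, h4⟩, h5⟩ := hu
    have a1 : |u.re| ≤ q := abs_le.2 ⟨h1, h2⟩
    have a2 : |u.im| ≤ q := abs_le.2 ⟨h3, h4⟩
    have b1 : ‖H (c + u)‖ ≤ B := hB _ (by simpa using a1) (by simpa using a2)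
    have b2 : ‖H (c + Complex.I * u)‖ ≤ B := hB _ (by simpa using a2) (by simpa using a1)
    have b3 : ‖H (c - u)‖ ≤ B := hB _ (by simpa using a1) (by simpa using a2)
    have b4 : ‖H (c - Complex.I * u)‖ ≤ B := hB _ (by simpa using a2) (by simpa using a1)
    have hcase : u.re = q ∨ u.re = -q ∨ u.im = q ∨ u.im = -q := by
      by_contra! hne
      exact h5 ⟨⟨lt_of_le_of_ne h1 (Ne.symm hne.2.1), lt_of_le_of_ne h2 hne.1⟩,
        lt_of_le_of_ne h3 (Ne.symm hne.2.2.2), lt_of_le_of_ne h4 hne.2.2.1⟩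
    simp only [P, norm_mul]
    rcases hcase with h | h | h | h
    · have : ‖H (c + u)‖ ≤ ε := hε _ (by simp [h]) (by simpa using a2)
      calc _ ≤ ε * B * B * B := by gcongr
        _ = _ := by ring
    · have : ‖H (c - u)‖ ≤ ε := hε _ (by simp [h]) (by simpa using a2)
      calc _ ≤ B * B * ε * B := by gcongr
        _ = _ := by ring
    · have : ‖H (c - Complex.I * u)‖ ≤ ε := hε _ (by simp [h]) (by simpa using a1)
      calc _ ≤ B * B * B * ε := by gcongr
        _ = _ := by ring
    · have : ‖H (c + Complex.I * u)‖ ≤ ε := hε _ (by simp [h]) (by simpa using a1)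
      calc _ ≤ B * ε * B * B := by gcongr
        _ = _ := by ring
  have h0 : (0 : ℂ) ∈ closure U := by
    rw [hclos]; constructor <;> simp [hq.le]
  have := Complex.norm_le_of_forall_mem_frontier_norm_le hbdd hP key h0
  simp only [P, norm_mul, mul_zero, add_zero, sub_zero] at this
  calc _ = ‖H c‖ * ‖H c‖ * ‖H c‖ * ‖H c‖ := by ring
    _ ≤ _ := this

/-- Fatou's theorem for the derivative of a Lipschitz function that is holomorphic to the left of the
imaginary axis: `deriv G` has a horizontal limit wherever the boundary function is
differentiable. -/
theorem tendsto_deriv_of_lipschitzWith {G : ℂ → ℂ} {K : NNReal} (hG : LipschitzWith K G) {a : ℝ}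
    (ha : 0 < a) (hd : ∀ w : ℂ, -a < w.re → w.re < 0 → DifferentiableAt ℂ G w) {t₀ : ℝ} {d : ℂ}
    (hφ : HasDerivAt (fun t : ℝ => G (t * Complex.I)) d t₀) :
    Tendsto (fun x : ℝ => deriv G (-x + t₀ * Complex.I)) (𝓝[>] 0) (𝓝 (-Complex.I * d)) := by
  set m : ℂ := -Complex.I * d with hm
  set w₀ : ℂ := t₀ * Complex.I with hw₀
  -- Subtracting the affine part with slope `m = -i d` makes `H` of size `o(t)` along the imaginary
  -- axis.
  let H : ℂ → ℂ := fun w => G (w + w₀) - G w₀ - m * w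
  set L : ℝ := K + ‖m‖ with hL
  have hL0 : 0 ≤ L := by positivity
  have hHc : Continuous H := by
    have := hG.continuous
    fun_prop
  have hHb : ∀ w, ‖H w‖ ≤ L * ‖w‖ := by
    intro w
    have h1 : ‖G (w + w₀) - G w₀‖ ≤ K * ‖w‖ := by
      simpa [dist_eq_norm] using hG.dist_le_mul (w + w₀) w₀
    calc ‖H w‖ ≤ ‖G (w + w₀) - G w₀‖ + ‖m * w‖ := norm_sub_le _ _
      _ ≤ K * ‖w‖ + ‖m‖ * ‖w‖ := by rw [norm_mul]; gcongr
      _ = _ := by rw [hL]; ring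
  have hHd : ∀ w : ℂ, -a < w.re → w.re < 0 → HasDerivAt H (deriv G (w + w₀) - m) w := by
    intro w h1 h2
    have h3 : HasDerivAt G (deriv G (w + w₀)) (w + w₀) :=
      (hd (w + w₀) (by simpa [hw₀] using h1) (by simpa [hw₀] using h2)).hasDerivAt
    have h4 := ((h3.comp_add_const w w₀).sub_const (G w₀)).sub ((hasDerivAt_id w).const_mul m)
    rw [mul_one] at h4
    exact h4
  rw [Metric.tendsto_nhds]
  intro η' hη'
  set η : ℝ := η' / 4 with hη
  have hη0 : 0 < η := by positivity
  -- The squares below have `ε * (2x)` on the right edge and `L * (5x)` overall; `2 * 5 ^ 3 = 250`,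
  -- and the `+ 1` covers `L = 0`.
  set ε : ℝ := η ^ 4 / (250 * L ^ 3 + 1) with hε
  have hε0 : 0 < ε := by positivity
  have hεη : 250 * L ^ 3 * ε ≤ η ^ 4 := by
    have : ε * (250 * L ^ 3 + 1) = η ^ 4 := by rw [hε]; field_simp
    nlinarith
  have hsmall : ∀ᶠ t : ℝ in 𝓝 0, ‖H (t * Complex.I)‖ ≤ ε * |t| := by
    have h1 := (hasDerivAt_iff_isLittleO_nhds_zero.1 hφ).bound hε0
    filter_upwards [h1] with t ht
    have : H (t * Complex.I) = G (((t₀ + t : ℝ) : ℂ) * Complex.I) - G (t₀ * Complex.I) - t • d := by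
      have e1 : (t : ℂ) * Complex.I + w₀ = ((t₀ + t : ℝ) : ℂ) * Complex.I := by
        rw [hw₀]; push_cast; ring
      have e2 : m * (t * Complex.I) = t • d := by
        rw [hm, Complex.real_smul]
        linear_combination (-d * t) * Complex.I_mul_I
      simp only [H, e1, e2]
      rw [hw₀]
    rw [this]
    simpa using ht
  obtain ⟨δ, hδ0, hδ⟩ := Metric.eventually_nhds_iff.1 hsmall
  have hlt : ∀ᶠ x : ℝ in 𝓝[>] 0, x < min (δ / 4) (a / 4) :=
    nhdsWithin_le_nhds (Iio_mem_nhds (by positivity))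
  filter_upwards [hlt, self_mem_nhdsWithin] with x hx hx0
  have hx0 : 0 < x := hx0
  have hxδ : x < δ / 4 := hx.trans_le (min_le_left _ _)
  have hxa : x < a / 4 := hx.trans_le (min_le_right _ _)
  -- The square about `c` reaching the imaginary axis has half-side at most `3x/2`, so it lies in
  -- `|re| ≤ 3x`, `|im| ≤ 2x`.
  have hdisc : ∀ c : ℂ, ‖c + x‖ ≤ x / 2 → ‖H c‖ ≤ η * x := by
    intro c hcx
    have r1 : |c.re + x| ≤ x / 2 := by simpa using (Complex.abs_re_le_norm (c + x)).trans hcx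
    have r2 : |c.im| ≤ x / 2 := by simpa using (Complex.abs_im_le_norm (c + x)).trans hcx
    rw [abs_le] at r1 r2
    have hq : 0 < -c.re := by linarith
    have := norm_center_pow_four_le (H := H) (c := c) (q := -c.re) (B := L * (5 * x))
      (ε := ε * (2 * x)) hq hHc ?_ ?_ ?_
    · refine le_of_pow_le_pow_left₀ (n := 4) (by norm_num) (by positivity) (this.trans ?_)
      calc ε * (2 * x) * (L * (5 * x)) ^ 3 = 250 * L ^ 3 * ε * x ^ 4 := by ring
        _ ≤ η ^ 4 * x ^ 4 := by gcongr
        _ = _ := by ring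
    · intro w h1 h2
      rw [abs_lt] at h1
      exact (hHd w (by linarith) (by linarith)).differentiableAt
    · intro w h1 h2
      rw [abs_le] at h1 h2
      refine (hHb w).trans ?_
      gcongr
      refine (Complex.norm_le_abs_re_add_abs_im w).trans ?_
      have s1 : |w.re| ≤ 3 * x := abs_le.2 ⟨by linarith, by linarith⟩
      have s2 : |w.im| ≤ 2 * x := abs_le.2 ⟨by linarith, by linarith⟩
      linarith
    · intro w h1 h2
      rw [abs_le] at h2
      have s2 : |w.im| ≤ 2 * x := abs_le.2 ⟨by linarith, by linarith⟩
      have e : w = (w.im : ℂ) * Complex.I := by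
        apply Complex.ext <;> simp [h1]
      rw [e]
      refine (hδ (y := w.im) ?_).trans (by gcongr)
      rw [Real.dist_eq, sub_zero]
      linarith
  have hcauchy := Complex.norm_deriv_le_of_forall_mem_sphere_norm_le (f := H) (c := -(x : ℂ))
    (R := x / 2) (C := η * x) (by positivity) ?_ ?_
  · have hx' : HasDerivAt H _ (-(x : ℂ)) := hHd (-(x : ℂ)) (by simp; linarith) (by simpa using hx0)
    rw [hx'.deriv] at hcauchy
    rw [dist_eq_norm]
    calc _ ≤ η * x / (x / 2) := hcauchy
      _ = η' / 2 := by rw [hη]; field_simp; ring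
      _ < η' := by linarith
  · refine ⟨fun w hw => ?_, hHc.continuousOn⟩
    rw [Metric.mem_ball, dist_eq_norm, sub_neg_eq_add] at hw
    have r1 : |w.re + x| ≤ x / 2 := by simpa using (Complex.abs_re_le_norm (w + x)).trans hw.le
    rw [abs_le] at r1
    exact (hHd w (by linarith) (by linarith)).differentiableAt.differentiableWithinAt
  · intro w hw
    rw [mem_sphere_iff_norm, sub_neg_eq_add] at hw
    exact hdisc w hw.le

/-- A Lipschitz curve whose speed is at most `C` almost everywhere is `C`-Lipschitz. -/
theorem norm_sub_le_of_ae_norm_deriv_le {φ : ℝ → ℂ} {K : NNReal} (hφ : LipschitzWith K φ) {C : ℝ}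
    (hC : ∀ᵐ t : ℝ, ‖deriv φ t‖ ≤ C) {a b : ℝ} (hab : a ≤ b) :
    ‖φ b - φ a‖ ≤ C * (b - a) := by
  set v : ℂ := φ b - φ a with hv
  rcases eq_or_ne v 0 with h0 | h0
  · obtain ⟨t, ht⟩ := hC.exists
    have : 0 ≤ C := (norm_nonneg _).trans ht
    rw [h0, norm_zero]
    exact mul_nonneg this (by linarith)
  -- Projecting onto the direction of the increment reduces to a real absolutely continuous
  -- function.
  let ℓ : ℂ →L[ℝ] ℝ := innerSL ℝ v
  have hℓ : ∀ z, ℓ z ≤ ‖v‖ * ‖z‖ := fun z => real_inner_le_norm v z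
  have hψ : LipschitzWith (‖ℓ‖₊ * K) (ℓ ∘ φ) := ℓ.lipschitz.comp hφ
  have hac := (hψ.lipschitzOnWith (s := Set.uIcc a b)).absolutelyContinuousOnInterval
  have hftc := hac.integral_deriv_eq_sub
  have hint : ∫ x in a..b, deriv (ℓ ∘ φ) x ≤ ∫ x in a..b, ‖v‖ * C := by
    refine intervalIntegral.integral_mono_ae hab hac.intervalIntegrable_deriv (by simp) ?_
    filter_upwards [hC, hφ.ae_differentiableAt_real] with t h1 h2
    have : HasDerivAt (ℓ ∘ φ) (ℓ (deriv φ t)) t := ℓ.hasFDerivAt.comp_hasDerivAt t h2.hasDerivAt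
    rw [this.deriv]
    exact (hℓ _).trans (by gcongr)
  rw [hftc] at hint
  have hvv : ℓ (φ b) - ℓ (φ a) = ‖v‖ * ‖v‖ := by
    rw [← map_sub, ← hv]
    exact real_inner_self_eq_norm_mul_norm v
  simp only [Function.comp_apply, hvv, intervalIntegral.integral_const, smul_eq_mul] at hint
  have : 0 < ‖v‖ := norm_pos_iff.2 h0
  nlinarith

/-- If `G` is Lipschitz, holomorphic on a vertical strip and moves with speed at most `C` along both
boundary lines, then its derivative is bounded by `C` on the strip. -/
theorem norm_deriv_le_of_strip {G : ℂ → ℂ} {K : NNReal} (hG : LipschitzWith K G) {a b C : ℝ}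
    (hd : ∀ w : ℂ, a < w.re → w.re < b → DifferentiableAt ℂ G w)
    (hC : 0 ≤ C)
    (hbd : ∀ w : ℂ, w.re = a ∨ w.re = b → ∀ h : ℝ, 0 ≤ h → ‖G (w + h * Complex.I) - G w‖ ≤ C * h)
    {w : ℂ} (hwa : a < w.re) (hwb : w.re < b) : ‖deriv G w‖ ≤ C := by
  have hin : ∀ h : ℝ, 0 ≤ h → ∀ w : ℂ, a < w.re → w.re < b →
      ‖G (w + h * Complex.I) - G w‖ ≤ C * h := by
    intro h hh w hwa hwb
    have hcont := hG.continuous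
    refine PhragmenLindelof.vertical_strip (a := a) (b := b)
      (f := fun w => G (w + h * Complex.I) - G w) ⟨fun u hu => ?_, by fun_prop⟩
      -- Both growth parameters are `0`: the increment of a Lipschitz map is bounded.
      ⟨0, by have := hwa.trans hwb; have := Real.pi_pos; exact div_pos this (by linarith), 0, ?_⟩
      (fun z hz => hbd z (Or.inl hz) h hh) (fun z hz => hbd z (Or.inr hz) h hh) hwa.le hwb.le
    · have h1 : DifferentiableAt ℂ (fun u => G (u + h * Complex.I)) u :=
        (hd (u + h * Complex.I) (by simpa using hu.1) (by simpa using hu.2)).comp u (by fun_prop)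
      exact (h1.sub (hd u hu.1 hu.2)).differentiableWithinAt
    · refine Asymptotics.IsBigO.of_bound (K * h) (Eventually.of_forall fun z => ?_)
      have := hG.dist_le_mul (z + h * Complex.I) z
      simpa [dist_eq_norm, abs_of_nonneg hh] using this
  have hder : HasDerivAt (fun t : ℝ => G (w + t * Complex.I)) (deriv G w * Complex.I) 0 := by
    have h1 : HasDerivAt G (deriv G w) (w + (0 : ℝ) * Complex.I) := by
      simpa using (hd w hwa hwb).hasDerivAt
    have h2 : HasDerivAt (fun t : ℝ => w + t * Complex.I) Complex.I 0 := by
      simpa using ((Complex.ofRealCLM.hasDerivAt (x := (0 : ℝ))).mul_const Complex.I).const_add w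
    exact h1.comp (0 : ℝ) h2
  have := hder.le_of_lip' hC (Eventually.of_forall fun t => ?_)
  · simpa using this
  rcases le_total 0 t with ht | ht
  · simpa [abs_of_nonneg ht] using hin t ht w hwa hwb
  · have := hin (-t) (by linarith) (w + t * Complex.I) (by simpa using hwa) (by simpa using hwb)
    rw [norm_sub_rev] at this
    simpa [abs_of_nonpos ht, add_assoc] using this

/-- The right edge is a translate of the half-plane case; the left edge is brought to it by the half
turn `w ↦ c - w`, which reverses both `t₀` and `d`. -/
theorem tendsto_deriv_of_lipschitzWith_strip {G : ℂ → ℂ} {K : NNReal} (hG : LipschitzWith K G)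
    {a b c : ℝ} (hab : a < b) (hc : c = a ∨ c = b)
    (hd : ∀ w : ℂ, a < w.re → w.re < b → DifferentiableAt ℂ G w) {t₀ : ℝ} {d : ℂ}
    (hφ : HasDerivAt (fun t : ℝ => G (c + t * Complex.I)) d t₀) :
    Tendsto (fun x : ℝ => deriv G (x + t₀ * Complex.I)) (𝓝[Set.Ioo a b] c)
      (𝓝 (-Complex.I * d)) := by
  have hba : 0 < b - a := by linarith
  rcases hc with rfl | rfl
  · have hL : LipschitzWith K (fun w => G (c - w)) := by
      refine LipschitzWith.of_dist_le_mul fun x y => (hG.dist_le_mul _ _).trans_eq ?_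
      rw [dist_sub_left]
    have h := tendsto_deriv_of_lipschitzWith (G := fun w => G (c - w)) hL hba
      (fun w h1 h2 => ?_) (t₀ := -t₀) (d := -d) ?_
    · have hx : Tendsto (fun x : ℝ => x - c) (𝓝[Set.Ioo c b] c) (𝓝[>] 0) := by
        refine tendsto_nhdsWithin_iff.2 ⟨?_, ?_⟩
        · have : Tendsto (fun x : ℝ => x - c) (𝓝 c) (𝓝 (c - c)) :=
            (continuous_id.sub continuous_const).tendsto c
          rw [sub_self] at this
          exact this.mono_left nhdsWithin_le_nhds
        · filter_upwards [self_mem_nhdsWithin] with x hx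
          exact sub_pos.2 hx.1
      have h' := (h.comp hx).neg
      rw [show -(-Complex.I * -d) = -Complex.I * d by ring] at h'
      refine h'.congr fun x => ?_
      simp only [Function.comp_apply, deriv_comp_const_sub, neg_neg]
      congr 1
      push_cast
      ring
    · exact (hd (c - w) (by simp; linarith) (by simp; linarith)).comp w (by fun_prop)
    · have h1 : HasDerivAt (fun t : ℝ => G (c + t * Complex.I)) d (-(-t₀)) := by simpa using hφ
      have h2 := h1.scomp (-t₀) (hasDerivAt_neg (-t₀))
      rw [neg_one_smul] at h2
      refine h2.congr_of_eventuallyEq (Eventually.of_forall fun t => ?_)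
      simp [sub_eq_add_neg]
  · have hL : LipschitzWith K (fun w => G (c + w)) := by
      refine LipschitzWith.of_dist_le_mul fun x y => (hG.dist_le_mul _ _).trans_eq ?_
      rw [dist_add_left]
    have h := tendsto_deriv_of_lipschitzWith (G := fun w => G (c + w)) hL hba
      (fun w h1 h2 => ?_) (t₀ := t₀) (d := d) hφ
    · have hx : Tendsto (fun x : ℝ => c - x) (𝓝[Set.Ioo a c] c) (𝓝[>] 0) := by
        refine tendsto_nhdsWithin_iff.2 ⟨?_, ?_⟩
        · have : Tendsto (fun x : ℝ => c - x) (𝓝 c) (𝓝 (c - c)) :=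
            (continuous_const.sub continuous_id).tendsto c
          rw [sub_self] at this
          exact this.mono_left nhdsWithin_le_nhds
        · filter_upwards [self_mem_nhdsWithin] with x hx
          exact sub_pos.2 hx.2
      refine (h.comp hx).congr fun x => ?_
      simp only [Function.comp_apply, deriv_comp_const_add]
      congr 1
      push_cast
      ring
    · exact (hd (c + w) (by simp; linarith) (by simpa using h2)).comp w (by fun_prop)

/-! ### Passage from the annulus to the strip -/

theorem exp_mem_annulus {s : ℝ} (hs0 : 0 < s) {w : ℂ} (h1 : Real.log s < w.re) (h2 : w.re < 0) :
    Complex.exp w ∈ annulus s := by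
  refine ⟨?_, ?_⟩ <;> rw [Complex.norm_exp]
  · exact (Real.log_lt_iff_lt_exp hs0).1 h1
  · rwa [Real.exp_lt_one_iff]

theorem isOpen_annulus (s : ℝ) : IsOpen (annulus s) :=
  (isOpen_lt continuous_const continuous_norm).inter (isOpen_lt continuous_norm continuous_const)

theorem exists_exp_eq_of_mem_annulus {s : ℝ} (hs0 : 0 < s) {z : ℂ} (hz : z ∈ annulus s) :
    ∃ w : ℂ, Real.log s < w.re ∧ w.re < 0 ∧ |w.im| ≤ Real.pi ∧ Complex.exp w = z := by
  have hz0 : 0 < ‖z‖ := hs0.trans hz.1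
  refine ⟨Complex.log z, ?_, ?_, ?_, Complex.exp_log (norm_pos_iff.1 hz0)⟩
  · rw [Complex.log_re]; exact Real.log_lt_log hs0 hz.1
  · rw [Complex.log_re]; exact Real.log_neg hz0 hz.2
  · rw [Complex.log_im]; exact Complex.abs_arg_le_pi z

theorem hasDerivAt_comp_exp {s : ℝ} (hs0 : 0 < s) {g : ℂ → ℂ} (hg : DifferentiableOn ℂ g (annulus s))
    {w : ℂ} (h1 : Real.log s < w.re) (h2 : w.re < 0) :
    HasDerivAt (fun w => g (Complex.exp w)) (deriv g (Complex.exp w) * Complex.exp w) w := by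
  have := (hg.differentiableAt ((isOpen_annulus s).mem_nhds (exp_mem_annulus hs0 h1 h2))).hasDerivAt
  exact this.comp w (Complex.hasDerivAt_exp w)

/-- `F` is a lift of `g` through the exponential map on the strip `log s < Re w < 0`. -/
def IsStripLift (s : ℝ) (g F : ℂ → ℂ) : Prop :=
  ∀ w : ℂ, Real.log s < w.re → w.re < 0 → F w = g (Complex.exp w)

theorem IsStripLift.hasDerivAt {s : ℝ} (hs0 : 0 < s) {g F : ℂ → ℂ} (hF : IsStripLift s g F)
    (hg : DifferentiableOn ℂ g (annulus s)) {w : ℂ} (h1 : Real.log s < w.re) (h2 : w.re < 0) :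
    HasDerivAt F (deriv g (Complex.exp w) * Complex.exp w) w := by
  refine (hasDerivAt_comp_exp hs0 hg h1 h2).congr_of_eventuallyEq ?_
  have hopen : IsOpen {w : ℂ | Real.log s < w.re ∧ w.re < 0} :=
    (isOpen_lt continuous_const Complex.continuous_re).inter
      (isOpen_lt Complex.continuous_re continuous_const)
  filter_upwards [hopen.mem_nhds ⟨h1, h2⟩] with u hu using hF u hu.1 hu.2

theorem convex_strip (a b : ℝ) : Convex ℝ {w : ℂ | a < w.re ∧ w.re < b} :=
  (convex_halfSpace_re_gt a).inter (convex_halfSpace_re_lt b)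

/-- A function with bounded derivative on the annulus lifts to a globally Lipschitz function. -/
theorem exists_lipschitzWith_isStripLift {s : ℝ} (hs0 : 0 < s) {g : ℂ → ℂ}
    (hg : DifferentiableOn ℂ g (annulus s)) {M : NNReal} (hM : ∀ z ∈ annulus s, ‖deriv g z‖ ≤ M) :
    ∃ F, LipschitzWith (lipschitzExtensionConstant ℂ * M) F ∧ IsStripLift s g F := by
  -- The strip is convex, unlike the annulus, and `|exp w| < 1` there, so the derivative bound `M`
  -- survives the lift.
  have hL : LipschitzOnWith M (fun w => g (Complex.exp w))
      {w : ℂ | Real.log s < w.re ∧ w.re < 0} := by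
    refine (convex_strip _ _).lipschitzOnWith_of_nnnorm_hasDerivWithin_le
      (f' := fun w => deriv g (Complex.exp w) * Complex.exp w)
      (fun w hw => (hasDerivAt_comp_exp hs0 hg hw.1 hw.2).hasDerivWithinAt) fun w hw => ?_
    have hmem := exp_mem_annulus hs0 hw.1 hw.2
    rw [← NNReal.coe_le_coe, coe_nnnorm, norm_mul]
    calc _ ≤ (M : ℝ) * 1 := mul_le_mul (hM _ hmem) hmem.2.le (norm_nonneg _) M.2
      _ = M := mul_one _
  obtain ⟨F, hF, hE⟩ := hL.extend_finite_dimension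
  exact ⟨F, hF, fun w h1 h2 => (hE ⟨h1, h2⟩).symm⟩

/-- Under `x = log ρ` the radial approach becomes a horizontal one. The filter must be nontrivial
for `limUnder` to return the limit. -/
theorem boundaryValue_exp_eq_of_tendsto {s : ℝ} (hs0 : 0 < s) (hs1 : s < 1) {g : ℂ → ℂ} {u : ℝ → ℂ}
    {w ℓ : ℂ} (hw : w.re = Real.log s ∨ w.re = 0)
    (hu : ∀ x ∈ Set.Ioo (Real.log s) 0, u x = g (Complex.exp (x + w.im * Complex.I)))
    (h : Tendsto u (𝓝[Set.Ioo (Real.log s) 0] w.re) (𝓝 ℓ)) :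
    boundaryValue s g (Complex.exp w) = ℓ := by
  have hn : ‖Complex.exp w‖ = Real.exp w.re := Complex.norm_exp w
  have hmem : ‖Complex.exp w‖ ∈ closure (Set.Ioo s 1) := by
    rw [closure_Ioo hs1.ne, hn]
    rcases hw with hw | hw <;> rw [hw]
    · rw [Real.exp_log hs0]; exact ⟨le_rfl, hs1.le⟩
    · rw [Real.exp_zero]; exact ⟨hs1.le, le_rfl⟩
  have : (𝓝[Set.Ioo s 1] ‖Complex.exp w‖).NeBot := mem_closure_iff_nhdsWithin_neBot.1 hmem
  have hlog : Tendsto Real.log (𝓝[Set.Ioo s 1] ‖Complex.exp w‖)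
      (𝓝[Set.Ioo (Real.log s) 0] w.re) := by
    refine tendsto_nhdsWithin_iff.2 ⟨?_, ?_⟩
    · have h1 := Real.continuousAt_log (x := ‖Complex.exp w‖) (by rw [hn]; exact (Real.exp_pos _).ne')
      have h2 : Real.log ‖Complex.exp w‖ = w.re := by rw [hn, Real.log_exp]
      have h3 := h1.tendsto
      rw [h2] at h3
      exact h3.mono_left nhdsWithin_le_nhds
    · filter_upwards [self_mem_nhdsWithin] with x hx
      exact ⟨Real.log_lt_log hs0 hx.1, Real.log_neg (hs0.trans hx.1) hx.2⟩
  refine Tendsto.limUnder_eq ((h.comp hlog).congr' ?_)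
  filter_upwards [self_mem_nhdsWithin] with x hx
  have hx0 : 0 < x := hs0.trans hx.1
  rw [Function.comp_apply, hu _ ⟨Real.log_lt_log hs0 hx.1, Real.log_neg hx0 hx.2⟩]
  congr 1
  have e1 : Complex.exp w = Complex.exp w.re * Complex.exp (w.im * Complex.I) := by
    rw [← Complex.exp_add, Complex.re_add_im]
  rw [Complex.exp_add, ← Complex.ofReal_exp, Real.exp_log hx0, hn]
  rw [e1, Complex.ofReal_exp, mul_div_cancel_left₀ _ (Complex.exp_ne_zero _)]

theorem tendsto_horizontal {F : ℂ → ℂ} (hF : Continuous F) (w : ℂ) (S : Set ℝ) :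
    Tendsto (fun x : ℝ => F (x + w.im * Complex.I)) (𝓝[S] w.re) (𝓝 (F w)) := by
  have h : Continuous fun x : ℝ => F (x + w.im * Complex.I) := by fun_prop
  have := h.tendsto w.re
  rw [Complex.re_add_im] at this
  exact this.mono_left nhdsWithin_le_nhds

theorem IsStripLift.boundaryValue_exp {s : ℝ} (hs0 : 0 < s) (hs1 : s < 1) {g F : ℂ → ℂ}
    (hF : IsStripLift s g F) (hc : Continuous F) {w : ℂ} (hw : w.re = Real.log s ∨ w.re = 0) :
    boundaryValue s g (Complex.exp w) = F w :=
  boundaryValue_exp_eq_of_tendsto hs0 hs1 hw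
    (fun x hx => hF _ (by simpa using hx.1) (by simpa using hx.2)) (tendsto_horizontal hc w _)

theorem IsStripLift.boundaryValue_deriv_exp {s : ℝ} (hs0 : 0 < s) (hs1 : s < 1) {g F : ℂ → ℂ}
    (hF : IsStripLift s g F) (hg : DifferentiableOn ℂ g (annulus s)) {K : NNReal}
    (hK : LipschitzWith K F) {w d : ℂ} (hw : w.re = Real.log s ∨ w.re = 0)
    (hd : HasDerivAt (fun t : ℝ => F (w.re + t * Complex.I)) d w.im) :
    boundaryValue s (deriv g) (Complex.exp w) = -Complex.I * d / Complex.exp w := by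
  have h := tendsto_deriv_of_lipschitzWith_strip hK (Real.log_neg hs0 hs1) hw
    (fun w h1 h2 => (hF.hasDerivAt hs0 hg h1 h2).differentiableAt) hd
  refine boundaryValue_exp_eq_of_tendsto hs0 hs1 hw (fun x hx => ?_)
    (h.div (tendsto_horizontal Complex.continuous_exp w _) (Complex.exp_ne_zero _))
  have := (hF.hasDerivAt hs0 hg (w := x + w.im * Complex.I) (by simpa using hx.1)
    (by simpa using hx.2)).deriv
  simp only [Pi.div_apply, this, mul_div_cancel_right₀ _ (Complex.exp_ne_zero _)]

/-! ### Null sets on circles and the interior derivative bound -/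

theorem ae_of_periodic {T : ℝ} (hT : 0 < T) {p : ℝ → Prop} (hp : ∀ t, p (t + T) ↔ p t)
    (h : ∀ᵐ t ∂volume.restrict (Set.Ioc 0 T), p t) : ∀ᵐ t : ℝ, p t := by
  have hfd := isAddFundamentalDomain_Ioc hT 0
  rw [zero_add] at hfd
  rw [ae_iff]
  refine hfd.measure_zero_of_invariant _ (fun g => ?_) ?_
  · obtain ⟨g, hg⟩ := g
    obtain ⟨n, rfl⟩ := AddSubgroup.mem_zmultiples_iff.1 hg
    have hper : Function.Periodic p T := fun t => propext (hp t)
    ext t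
    rw [Set.mem_vadd_set_iff_neg_vadd_mem]
    have : p (-(n • T) + t) = p t := by
      rw [neg_add_eq_sub]; exact hper.sub_zsmul_eq n
    change ¬ p (-(n • T) + t) ↔ ¬ p t
    rw [this]
  · rw [← Measure.restrict_apply' measurableSet_Ioc]
    exact h

theorem measurable_circle_param (r : ℝ) :
    Measurable fun θ : ℝ => (r : ℂ) * Complex.exp (θ * Complex.I) := by
  fun_prop

theorem ae_circle_of_ae_circleMeasure {r : ℝ} {p : ℂ → Prop} (h : ∀ᵐ z ∂circleMeasure r, p z) :
    ∀ᵐ θ : ℝ, p (r * Complex.exp (θ * Complex.I)) := by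
  refine ae_of_periodic Real.two_pi_pos (fun t => ?_) ?_
  · have : Complex.exp (((t + 2 * Real.pi : ℝ) : ℂ) * Complex.I) = Complex.exp (t * Complex.I) := by
      rw [← Complex.exp_periodic (t * Complex.I)]
      congr 1
      push_cast
      ring
    rw [this]
  · refine ae_of_ae_map (measurable_circle_param r).aemeasurable ?_
    refine (Measure.ae_ennreal_smul_measure_iff ?_).1 h
    simp [Real.pi_pos]

theorem norm_le_ae_of_linftyCircleNorm_le {s c : ℝ} {g : ℂ → ℂ}
    (h : linftyCircleNorm s (Real.exp c) g ≤ 1) :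
    ∀ᵐ θ : ℝ, ‖boundaryValue s g (Complex.exp (c + θ * Complex.I))‖ ≤ 1 := by
  have h1 : ∀ᵐ z ∂circleMeasure (Real.exp c), ‖boundaryValue s g z‖ ≤ 1 := by
    rw [linftyCircleNorm, eLpNorm_exponent_top] at h
    filter_upwards [ae_le_eLpNormEssSup (f := boundaryValue s g) (μ := circleMeasure (Real.exp c))]
      with z hz
    have := hz.trans h
    rwa [← ofReal_norm, ENNReal.ofReal_le_one] at this
  filter_upwards [ae_circle_of_ae_circleMeasure h1] with θ hθ
  rwa [Complex.exp_add, ← Complex.ofReal_exp]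

theorem lipschitzWith_vertical {F : ℂ → ℂ} {K : NNReal} (hF : LipschitzWith K F) (c : ℝ) :
    LipschitzWith K (fun t : ℝ => F (c + t * Complex.I)) := by
  refine LipschitzWith.of_dist_le_mul fun x y => (hF.dist_le_mul _ _).trans (le_of_eq ?_)
  congr 1
  rw [dist_add_left, dist_eq_norm, ← sub_mul, ← Complex.ofReal_sub]
  rw [norm_mul, Complex.norm_I, mul_one, Complex.norm_real, Real.dist_eq, Real.norm_eq_abs]

/-- A bound for the boundary values of a derivative gives a bound inside the annulus. -/
theorem norm_deriv_le_of_linftyCircleNorm_le {s : ℝ} (hs0 : 0 < s) (hs1 : s < 1) {g : ℂ → ℂ}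
    (hg : DifferentiableOn ℂ g (annulus s)) (hM : ∃ M : ℝ, ∀ z ∈ annulus s, ‖deriv g z‖ ≤ M)
    (h1 : linftyCircleNorm s s (deriv g) ≤ 1) (h2 : linftyCircleNorm s 1 (deriv g) ≤ 1)
    {z : ℂ} (hz : z ∈ annulus s) : ‖deriv g z‖ ≤ s⁻¹ := by
  obtain ⟨M, hM⟩ := hM
  obtain ⟨F, hFL, hF⟩ := exists_lipschitzWith_isStripLift hs0 hg (M := M.toNNReal)
    fun z hz => (hM z hz).trans (Real.le_coe_toNNReal M)
  -- The boundary value of `deriv g` is `-i d / exp w`, so a bound by `1` gives `|d| ≤ |exp w| ≤ 1`.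
  have hline : ∀ c : ℝ, (c = Real.log s ∨ c = 0) → ∀ᵐ t : ℝ,
      ‖deriv (fun t : ℝ => F (c + t * Complex.I)) t‖ ≤ 1 := by
    intro c hc
    have hb : linftyCircleNorm s (Real.exp c) (deriv g) ≤ 1 := by
      rcases hc with rfl | rfl
      · rwa [Real.exp_log hs0]
      · rwa [Real.exp_zero]
    have hcL := lipschitzWith_vertical hFL c
    filter_upwards [norm_le_ae_of_linftyCircleNorm_le hb, hcL.ae_differentiableAt_real]
      with t ht hdt
    have := hF.boundaryValue_deriv_exp hs0 hs1 hg hFL (w := c + t * Complex.I)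
      (d := deriv (fun t : ℝ => F (c + t * Complex.I)) t) (by simpa using hc)
      (by simpa using hdt.hasDerivAt)
    rw [this, norm_div, Complex.norm_exp] at ht
    have hexp : Real.exp ((c : ℂ) + t * Complex.I).re ≤ 1 := by
      rw [Real.exp_le_one_iff]
      rcases hc with rfl | rfl
      · simpa using (Real.log_neg hs0 hs1).le
      · simp
    rw [div_le_one (Real.exp_pos _)] at ht
    simpa using ht.trans hexp
  obtain ⟨w, hw1, hw2, -, rfl⟩ := exists_exp_eq_of_mem_annulus hs0 hz
  have hd := norm_deriv_le_of_strip hFL (a := Real.log s) (b := 0) (C := 1)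
    (fun w h1 h2 => (hF.hasDerivAt hs0 hg h1 h2).differentiableAt) zero_le_one ?_ hw1 hw2
  -- The lift has derivative `g' * exp w` of size at most `1`; dividing by `|exp w| > s` costs the
  -- factor `s⁻¹`.
  · rw [(hF.hasDerivAt hs0 hg hw1 hw2).deriv, norm_mul] at hd
    rw [← one_div, le_div_iff₀ hs0]
    exact (mul_le_mul_of_nonneg_left hz.1.le (norm_nonneg _)).trans hd
  · intro u hu h hh
    have hcL := lipschitzWith_vertical hFL u.re
    have := norm_sub_le_of_ae_norm_deriv_le hcL (hline u.re hu) (a := u.im) (b := u.im + h)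
      (by linarith)
    have e : (u.re : ℂ) + ((u.im + h : ℝ) : ℂ) * Complex.I = u + h * Complex.I := by
      push_cast
      rw [add_mul, ← add_assoc, Complex.re_add_im]
    rw [e, Complex.re_add_im] at this
    simpa using this

/-! ### Uniqueness from a boundary segment -/

/-- The four-turn estimate with `ε = 0` kills `G` at the centre of every small square whose right
edge lies in the segment. These centres fill an open set, so the identity theorem and continuity
finish. -/
theorem eq_zero_of_right_segment {G : ℂ → ℂ} (hG : Continuous G) {a b t₀ δ : ℝ} (hab : a < b)
    (hδ : 0 < δ) (hd : ∀ w : ℂ, a < w.re → w.re < b → DifferentiableAt ℂ G w)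
    (hseg : ∀ t : ℝ, |t - t₀| < δ → G (b + t * Complex.I) = 0) {w : ℂ} (ha : a ≤ w.re)
    (hb : w.re ≤ b) : G w = 0 := by
  have hzero : ∀ c : ℂ, (a + b) / 2 < c.re → c.re < b → b - c.re < δ / 2 → |c.im - t₀| < δ / 2 →
      G c = 0 := by
    intro c h1 h2 h3 h4
    have hq : 0 < b - c.re := by linarith
    obtain ⟨B, hB⟩ := ((isCompact_Icc (a := c.re - (b - c.re)) (b := c.re + (b - c.re))).reProdIm
      (isCompact_Icc (a := c.im - (b - c.re)) (b := c.im + (b - c.re)))).exists_bound_of_continuousOn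
      hG.continuousOn
    have := norm_center_pow_four_le (H := G) (c := c) (q := b - c.re) (B := B) (ε := 0) hq hG ?_ ?_ ?_
    · rw [zero_mul] at this
      have h0 : ‖G c‖ ^ 4 = 0 := le_antisymm this (by positivity)
      exact norm_eq_zero.1 (pow_eq_zero_iff (by norm_num) |>.1 h0)
    · intro w hw _
      rw [abs_lt] at hw
      exact hd w (by linarith) (by linarith)
    · intro w hw1 hw2
      rw [abs_le] at hw1 hw2
      exact hB w ⟨⟨by linarith, by linarith⟩, ⟨by linarith, by linarith⟩⟩
    · intro w hw1 hw2
      have hwb : w.re = b := by linarith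
      have h := hseg w.im (by
        have := abs_sub_le w.im c.im t₀
        linarith)
      rw [← hwb, Complex.re_add_im] at h
      rw [h, norm_zero]
  have hopen : IsOpen (Complex.re ⁻¹' Set.Ioo a b) := isOpen_Ioo.preimage Complex.continuous_re
  have hdo : DifferentiableOn ℂ G (Complex.re ⁻¹' Set.Ioo a b) :=
    fun w hw => (hd w hw.1 hw.2).differentiableWithinAt
  set x₀ : ℝ := b - min (δ / 4) ((b - a) / 4) with hx₀
  have hm : 0 < min (δ / 4) ((b - a) / 4) := lt_min (by linarith) (by linarith)
  have hm1 : min (δ / 4) ((b - a) / 4) ≤ δ / 4 := min_le_left _ _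
  have hm2 : min (δ / 4) ((b - a) / 4) ≤ (b - a) / 4 := min_le_right _ _
  have hN : (fun w => G w) =ᶠ[𝓝 (⟨x₀, t₀⟩ : ℂ)] 0 := by
    have ho : IsOpen {c : ℂ | (a + b) / 2 < c.re ∧ c.re < b ∧ b - c.re < δ / 2 ∧
        |c.im - t₀| < δ / 2} := by
      have hre := Complex.continuous_re
      have him := Complex.continuous_im
      exact (isOpen_lt continuous_const hre).inter ((isOpen_lt hre continuous_const).inter
        ((isOpen_lt (continuous_const.sub hre) continuous_const).inter
        (isOpen_lt (him.sub continuous_const).abs continuous_const)))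
    filter_upwards [ho.mem_nhds (x := (⟨x₀, t₀⟩ : ℂ))
      ⟨by simp only [hx₀]; linarith, by simp only [hx₀]; linarith, by simp only [hx₀]; linarith,
        by simpa using hδ⟩] with c hc
    exact hzero c hc.1 hc.2.1 hc.2.2.1 hc.2.2.2
  have hE := (hdo.analyticOnNhd hopen).eqOn_zero_of_preconnected_of_eventuallyEq_zero
    (convex_strip a b).isPreconnected
    (⟨by simp only [hx₀]; linarith, by simp only [hx₀]; linarith⟩ :
      (⟨x₀, t₀⟩ : ℂ) ∈ Complex.re ⁻¹' Set.Ioo a b) hN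
  refine hE.closure hG continuous_const ?_
  rw [Complex.closure_preimage_re, closure_Ioo hab.ne]
  exact ⟨ha, hb⟩

/-- A continuous function on a closed strip that is holomorphic inside and vanishes on a segment of
the boundary vanishes identically. -/
theorem eq_zero_of_boundary_segment {G : ℂ → ℂ} (hG : Continuous G) {a b c t₀ δ : ℝ} (hab : a < b)
    (hc : c = a ∨ c = b)
    (hδ : 0 < δ) (hd : ∀ w : ℂ, a < w.re → w.re < b → DifferentiableAt ℂ G w)
    (hseg : ∀ t : ℝ, |t - t₀| < δ → G (c + t * Complex.I) = 0) {w : ℂ} (ha : a ≤ w.re)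
    (hb : w.re ≤ b) : G w = 0 := by
  rcases hc with rfl | rfl
  · have := eq_zero_of_right_segment (G := fun w => G (c + b - w)) (by fun_prop) (t₀ := -t₀) hab hδ
      (fun w h1 h2 => (hd (c + b - w) (by simp; linarith) (by simp; linarith)).comp w (by fun_prop))
      (fun t ht => ?_) (w := c + b - w) (by simp; linarith) (by simp; linarith)
    · simpa using this
    · have h := hseg (-t) (by rw [← abs_neg]; convert ht using 2; ring)
      rw [← h]
      congr 1
      push_cast
      ring
  · exact eq_zero_of_right_segment hG hab hδ hd hseg ha hb

/-! ### Convergence of equi-Lipschitz sequences -/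

/-- Uniformly Lipschitz holomorphic functions on a strip that tend to zero on a segment of the
boundary tend to zero everywhere on the closed strip. -/
theorem tendsto_zero_of_boundary_segment {F : ℕ → ℂ → ℂ} {K : NNReal}
    (hF : ∀ p, LipschitzWith K (F p)) {a b c t₀ δ : ℝ} (hab : a < b) (hc : c = a ∨ c = b)
    (hδ : 0 < δ) (hd : ∀ p, ∀ w : ℂ, a < w.re → w.re < b → DifferentiableAt ℂ (F p) w)
    (hseg : ∀ t : ℝ, |t - t₀| < δ → Tendsto (fun p => F p (c + t * Complex.I)) atTop (𝓝 0)) {w : ℂ}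
    (ha : a ≤ w.re) (hb : w.re ≤ b) : Tendsto (fun p => F p w) atTop (𝓝 0) := by
  refine (tendsto_iff_ultrafilter _ _ _).2 fun U hU => ?_
  set w₀ : ℂ := c + t₀ * Complex.I with hw₀
  -- The ultrafilter replaces the choice of subsequences: values at `v` stay bounded by comparison
  -- with `w₀`, hence converge along `U`.
  have hlim : ∀ v : ℂ, ∃ ℓ, Tendsto (fun p => F p v) U (𝓝 ℓ) := by
    intro v
    have h0 : ∀ᶠ p in (U : Filter ℕ), ‖F p w₀‖ < 1 := by
      have := ((hseg t₀ (by simpa using hδ)).mono_left hU).norm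
      rw [norm_zero] at this
      exact this.eventually_lt_const one_pos
    have h1 : ∀ᶠ p in (U : Filter ℕ), F p v ∈ Metric.closedBall (0 : ℂ) (1 + K * dist v w₀) := by
      filter_upwards [h0] with p hp
      rw [mem_closedBall_zero_iff]
      have h2 := (hF p).dist_le_mul v w₀
      rw [dist_eq_norm] at h2
      have h3 := norm_le_norm_add_norm_sub' (F p v) (F p w₀)
      linarith
    obtain ⟨ℓ, -, hℓ⟩ := (isCompact_closedBall (0 : ℂ) (1 + K * dist v w₀)).ultrafilter_le_nhds
      (U.map fun p => F p v) (Filter.le_principal_iff.2 h1)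
    exact ⟨ℓ, hℓ⟩
  choose G hG using hlim
  have hGL : LipschitzWith K G := by
    refine LipschitzWith.of_dist_le_mul fun x y => ?_
    exact le_of_tendsto ((hG x).dist (hG y)) (Eventually.of_forall fun p => (hF p).dist_le_mul x y)
  have hunif : TendstoLocallyUniformlyOn F G U (Complex.re ⁻¹' Set.Ioo a b) := by
    rw [Metric.tendstoLocallyUniformlyOn_iff]
    intro ε hε x _
    have hr : 0 < ε / (3 * (K + 1)) := by positivity
    refine ⟨Metric.ball x (ε / (3 * (K + 1))), mem_nhdsWithin_of_mem_nhds (Metric.ball_mem_nhds x hr),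
      ?_⟩
    have hx : ∀ᶠ p in (U : Filter ℕ), dist (F p x) (G x) < ε / 3 :=
      Metric.tendsto_nhds.1 (hG x) _ (by positivity)
    filter_upwards [hx] with p hp y hy
    have hk : K * dist y x ≤ ε / 3 := by
      have : (K : ℝ) * dist y x ≤ (K + 1) * (ε / (3 * (K + 1))) := by
        gcongr
        · linarith
        · exact (Metric.mem_ball.1 hy).le
      refine this.trans (le_of_eq ?_)
      field_simp
    have h1 := hGL.dist_le_mul y x
    have h2 := (hF p).dist_le_mul y x
    have h3 := dist_triangle4 (G y) (G x) (F p x) (F p y)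
    rw [dist_comm (G x), dist_comm (F p x) (F p y)] at h3
    linarith
  have hopen : IsOpen (Complex.re ⁻¹' Set.Ioo a b) := isOpen_Ioo.preimage Complex.continuous_re
  have hGd : DifferentiableOn ℂ G (Complex.re ⁻¹' Set.Ioo a b) :=
    hunif.differentiableOn (Eventually.of_forall fun p w hw =>
      (hd p w hw.1 hw.2).differentiableWithinAt) hopen
  have : G w = 0 := by
    refine eq_zero_of_boundary_segment (t₀ := t₀) hGL.continuous hab hc hδ
      (fun v h1 h2 => hGd.differentiableAt (hopen.mem_nhds ⟨h1, h2⟩)) (fun t ht => ?_) ha hb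
    exact tendsto_nhds_unique (hG _) ((hseg t ht).mono_left hU)
  exact this ▸ hG w

theorem eventually_norm_le_of_isCompact {F : ℕ → ℂ → ℂ} {K : NNReal}
    (hF : ∀ p, LipschitzWith K (F p)) {S : Set ℂ} (hS : IsCompact S)
    (h : ∀ w ∈ S, Tendsto (fun p => F p w) atTop (𝓝 0)) {ε : ℝ} (hε : 0 < ε) :
    ∀ᶠ p in atTop, ∀ w ∈ S, ‖F p w‖ ≤ ε := by
  refine hS.induction_on (p := fun T => ∀ᶠ p in atTop, ∀ w ∈ T, ‖F p w‖ ≤ ε) (by simp)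
    (fun T T' hT hp => hp.mono fun p hp w hw => hp w (hT hw))
    (fun T T' hT hT' => ?_) (fun x hx => ?_)
  · filter_upwards [hT, hT'] with p h1 h2 w hw
    exact hw.elim (h1 w) (h2 w)
  · have hr : 0 < ε / (2 * (K + 1)) := by positivity
    refine ⟨Metric.ball x (ε / (2 * (K + 1))), mem_nhdsWithin_of_mem_nhds (Metric.ball_mem_nhds x hr),
      ?_⟩
    have h0 : ∀ᶠ p in atTop, ‖F p x‖ < ε / 2 := by
      have := (h x hx).norm
      rw [norm_zero] at this
      exact this.eventually_lt_const (by positivity)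
    filter_upwards [h0] with p hp y hy
    have hk : K * dist y x ≤ ε / 2 := by
      have : (K : ℝ) * dist y x ≤ (K + 1) * (ε / (2 * (K + 1))) := by
        gcongr
        · linarith
        · exact (Metric.mem_ball.1 hy).le
      refine this.trans (le_of_eq ?_)
      field_simp
    have h2 := (hF p).dist_le_mul y x
    rw [dist_eq_norm] at h2
    have h3 := norm_le_norm_add_norm_sub' (F p y) (F p x)
    linarith

theorem tendsto_zero_of_mem_closure {F : ℕ → ℂ → ℂ} {K : NNReal}
    (hF : ∀ p, LipschitzWith K (F p)) {S : Set ℂ}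
    (h : ∀ w ∈ S, Tendsto (fun p => F p w) atTop (𝓝 0)) {w : ℂ} (hw : w ∈ closure S) :
    Tendsto (fun p => F p w) atTop (𝓝 0) := by
  rw [tendsto_zero_iff_norm_tendsto_zero, Metric.tendsto_nhds]
  intro ε hε
  obtain ⟨v, hv, hvw⟩ := Metric.mem_closure_iff.1 hw (ε / (2 * (K + 1))) (by positivity)
  have h0 : ∀ᶠ p in atTop, ‖F p v‖ < ε / 2 := by
    have := (h v hv).norm
    rw [norm_zero] at this
    exact this.eventually_lt_const (by positivity)
  filter_upwards [h0] with p hp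
  have hk : K * dist w v ≤ ε / 2 := by
    have : (K : ℝ) * dist w v ≤ (K + 1) * (ε / (2 * (K + 1))) := by
      gcongr
      linarith
    refine this.trans (le_of_eq ?_)
    field_simp
  have h2 := (hF p).dist_le_mul w v
  rw [dist_eq_norm] at h2
  have h3 := norm_le_norm_add_norm_sub' (F p w) (F p v)
  rw [Real.dist_eq, sub_zero, abs_norm]
  linarith

theorem tendsto_deriv_zero {F : ℕ → ℂ → ℂ} {K : NNReal} (hF : ∀ p, LipschitzWith K (F p))
    {S : Set ℂ} (hS : IsOpen S) (hd : ∀ p, DifferentiableOn ℂ (F p) S)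
    (h : ∀ w ∈ S, Tendsto (fun p => F p w) atTop (𝓝 0)) {w : ℂ} (hw : w ∈ S) :
    Tendsto (fun p => deriv (F p) w) atTop (𝓝 0) := by
  obtain ⟨r, hr, hrS⟩ := Metric.nhds_basis_closedBall.mem_iff.1 (hS.mem_nhds hw)
  rw [tendsto_zero_iff_norm_tendsto_zero, Metric.tendsto_nhds]
  intro ε hε
  filter_upwards [eventually_norm_le_of_isCompact hF (isCompact_closedBall w r)
    (fun v hv => h v (hrS hv)) (by positivity : 0 < ε / 2 * r)] with p hp
  have := Complex.norm_deriv_le_of_forall_mem_sphere_norm_le hr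
    (((hd p).mono hrS).diffContOnCl_ball subset_rfl)
    (fun v hv => hp v (Metric.sphere_subset_closedBall hv))
  rw [mul_div_cancel_right₀ _ hr.ne'] at this
  rw [Real.dist_eq, sub_zero, abs_norm]
  linarith

/-! ### From `L¹` smallness on an arc to pointwise convergence -/

theorem circleMeasure_inter_sphere_pos {r : ℝ} (hr : 0 ≤ r) {V : Set ℂ} (hV : IsOpen V) {θ : ℝ}
    (hθ : (r : ℂ) * Complex.exp (θ * Complex.I) ∈ V) :
    0 < circleMeasure r (V ∩ Metric.sphere 0 r) := by
  rw [pos_iff_ne_zero]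
  intro h0
  have h1 : ∀ᵐ z ∂circleMeasure r, z ∉ V ∩ Metric.sphere 0 r := measure_eq_zero_iff_ae_notMem.1 h0
  have h2 := Measure.dense_of_ae (ae_circle_of_ae_circleMeasure h1)
  have ho : IsOpen ((fun t : ℝ => (r : ℂ) * Complex.exp (t * Complex.I)) ⁻¹' V) :=
    hV.preimage (by fun_prop)
  obtain ⟨t, ht1, ht2⟩ := h2.inter_open_nonempty _ ho ⟨θ, hθ⟩
  refine ht2 ⟨ht1, ?_⟩
  rw [mem_sphere_zero_iff_norm, norm_mul, Complex.norm_exp_ofReal_mul_I, mul_one, Complex.norm_real,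
    Real.norm_of_nonneg hr]

theorem linftyCircleNorm_le {s r ε : ℝ} (hr : 0 ≤ r) {g : ℂ → ℂ}
    (h : ∀ z ∈ Metric.sphere (0 : ℂ) r, ‖boundaryValue s g z‖ ≤ ε) :
    linftyCircleNorm s r g ≤ ENNReal.ofReal ε := by
  rw [linftyCircleNorm, eLpNorm_exponent_top]
  refine eLpNormEssSup_le_of_ae_bound ?_
  have : ∀ᵐ z ∂circleMeasure r, z ∈ Metric.sphere (0 : ℂ) r := by
    refine Measure.ae_smul_measure ?_ _
    refine (ae_map_iff (measurable_circle_param r).aemeasurable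
      Metric.isClosed_sphere.measurableSet).2 (Eventually.of_forall fun t => ?_)
    rw [dist_zero_right, norm_mul, Complex.norm_exp_ofReal_mul_I, mul_one,
      Complex.norm_real, Real.norm_of_nonneg hr]
  filter_upwards [this] with z hz using h z hz

theorem circleMeasure_univ_le_one (r : ℝ) : circleMeasure r Set.univ ≤ 1 := by
  rw [circleMeasure, Measure.smul_apply, Measure.map_apply (measurable_circle_param r) .univ,
    Set.preimage_univ, Measure.restrict_apply_univ, Real.volume_Ioc, smul_eq_mul,
    ← ENNReal.ofReal_mul (by positivity), sub_zero, inv_mul_cancel₀ (by positivity),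
    ENNReal.ofReal_one]

theorem tendsto_lintegral_of_tendsto_l1ArcNorm {s : ℝ} {I : Set ℂ} {f : ℕ → ℂ → ℂ}
    (h : Tendsto (fun p => l1ArcNorm s I (f p)) atTop (𝓝 0)) :
    Tendsto (fun p => ∫⁻ z in I, ‖boundaryValue s (f p) z‖ₑ ∂(boundaryMeasure s)) atTop (𝓝 0) := by
  have h2 : boundaryMeasure s I ≤ 2 := by
    refine (measure_mono (Set.subset_univ I)).trans ?_
    rw [boundaryMeasure, Measure.add_apply, ← one_add_one_eq_two]
    exact add_le_add (circleMeasure_univ_le_one s) (circleMeasure_univ_le_one 1)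
  have h3 : Tendsto (fun p => 2 * l1ArcNorm s I (f p)) atTop (𝓝 0) := by
    simpa using ENNReal.Tendsto.const_mul h (Or.inr (by simp : (2 : ℝ≥0∞) ≠ ∞))
  refine tendsto_of_tendsto_of_tendsto_of_le_of_le tendsto_const_nhds h3 (fun _ => zero_le) ?_
  intro p
  have h4 : 1 ≤ 2 * (boundaryMeasure s I)⁻¹ := by
    calc (1 : ℝ≥0∞) = 2 * 2⁻¹ := (ENNReal.mul_inv_cancel (by simp) (by simp)).symm
      _ ≤ _ := by gcongr
  calc _ = 1 * ∫⁻ z in I, ‖boundaryValue s (f p) z‖ₑ ∂(boundaryMeasure s) := (one_mul _).symm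
    _ ≤ 2 * (boundaryMeasure s I)⁻¹ * ∫⁻ z in I, ‖boundaryValue s (f p) z‖ₑ ∂(boundaryMeasure s) := by
      gcongr
    _ = _ := mul_assoc _ _ _

theorem exp_re_mem {s : ℝ} (hs0 : 0 < s) {c : ℝ} (hc : c = Real.log s ∨ c = 0) :
    Real.exp c = s ∨ Real.exp c = 1 := by
  rcases hc with rfl | rfl
  · exact Or.inl (Real.exp_log hs0)
  · exact Or.inr Real.exp_zero

/-- Convergence to zero in `L¹` of an arc, for uniformly Lipschitz lifts, is pointwise. -/
theorem tendsto_zero_of_tendsto_l1ArcNorm {s : ℝ} (hs0 : 0 < s) (hs1 : s < 1) {U : Set ℂ}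
    (hU : IsOpen U) {f F : ℕ → ℂ → ℂ} {K : NNReal} (hF : ∀ p, IsStripLift s (f p) (F p))
    (hK : ∀ p, LipschitzWith K (F p))
    (h : Tendsto (fun p => l1ArcNorm s (U ∩ annulusBoundary s) (f p)) atTop (𝓝 0)) {w : ℂ}
    (hw : w.re = Real.log s ∨ w.re = 0) (hwU : Complex.exp w ∈ U) :
    Tendsto (fun p => F p w) atTop (𝓝 0) := by
  rw [tendsto_zero_iff_norm_tendsto_zero, Metric.tendsto_nhds]
  intro ε hε
  have hz0 := Complex.exp_ne_zero w
  have hcont : ContinuousAt (fun z => K * ‖Complex.log (z / Complex.exp w)‖) (Complex.exp w) := by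
    have h1 : ContinuousAt (fun z => z / Complex.exp w) (Complex.exp w) := by fun_prop
    exact continuousAt_const.mul (h1.clog (by simp)).norm
  -- For `z` near `exp w`, the point `w + log (z / exp w)` is a preimage close to `w`, so each lift
  -- changes by less than `ε / 2`, uniformly in `p`.
  have hev : ∀ᶠ z in 𝓝 (Complex.exp w), K * ‖Complex.log (z / Complex.exp w)‖ < ε / 2 ∧ z ∈ U := by
    refine (hcont.eventually_lt_const ?_).and (hU.mem_nhds hwU)
    simpa using hε
  obtain ⟨V, hV, hVo, hwV⟩ := eventually_nhds_iff.1 hev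
  set r : ℝ := Real.exp w.re with hr
  set A : Set ℂ := V ∩ Metric.sphere 0 r with hA
  have hpos : 0 < circleMeasure r A := by
    refine circleMeasure_inter_sphere_pos (Real.exp_pos _).le hVo (θ := w.im) ?_
    rwa [Complex.ofReal_exp, ← Complex.exp_add, Complex.re_add_im]
  have hAI : A ⊆ U ∩ annulusBoundary s := by
    rintro z ⟨h1, h2⟩
    refine ⟨(hV z h1).2, ?_⟩
    rcases exp_re_mem hs0 hw with h | h
    · rw [hr, h] at h2; exact Or.inl h2
    · rw [hr, h] at h2; exact Or.inr h2
  have hle : circleMeasure r A ≤ boundaryMeasure s A := by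
    rw [boundaryMeasure, Measure.add_apply]
    rcases exp_re_mem hs0 hw with h | h
    · rw [hr, h]; exact le_self_add
    · rw [hr, h]; exact le_add_self
  have hAm : MeasurableSet A := hVo.measurableSet.inter Metric.isClosed_sphere.measurableSet
  have hm : 0 < ENNReal.ofReal (ε / 2) * boundaryMeasure s A :=
    ENNReal.mul_pos (by simpa using hε) (hpos.trans_le hle).ne'
  filter_upwards [(tendsto_lintegral_of_tendsto_l1ArcNorm h).eventually_lt_const hm] with p hp
  rw [Real.dist_eq, sub_zero, abs_norm]
  -- Otherwise the boundary values have size at least `ε / 2` on all of `A`, whose measure is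
  -- positive and independent of `p`.
  by_contra! hge
  refine hp.not_ge ?_
  calc _ = ∫⁻ _ in A, ENNReal.ofReal (ε / 2) ∂(boundaryMeasure s) := (setLIntegral_const _ _).symm
    _ ≤ ∫⁻ z in A, ‖boundaryValue s (f p) z‖ₑ ∂(boundaryMeasure s) := by
      refine setLIntegral_mono' hAm fun z hz => ?_
      have hzr : ‖z‖ = r := mem_sphere_zero_iff_norm.1 hz.2
      have hzne : z ≠ 0 := norm_pos_iff.1 (hzr ▸ Real.exp_pos _)
      have hexp : Complex.exp (w + Complex.log (z / Complex.exp w)) = z := by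
        rw [Complex.exp_add, Complex.exp_log (div_ne_zero hzne hz0), mul_div_cancel₀ _ hz0]
      have hre : (w + Complex.log (z / Complex.exp w)).re = w.re := by
        rw [Complex.add_re, Complex.log_re, norm_div, hzr, Complex.norm_exp, div_self
          (Real.exp_pos _).ne', Real.log_one, add_zero]
      have hb := (hF p).boundaryValue_exp hs0 hs1 (hK p).continuous
        (w := w + Complex.log (z / Complex.exp w)) (by rwa [hre])
      rw [hexp] at hb
      rw [hb, ← ofReal_norm]
      refine ENNReal.ofReal_le_ofReal ?_
      have h1 := (hK p).dist_le_mul w (w + Complex.log (z / Complex.exp w))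
      rw [dist_self_add_right, dist_eq_norm] at h1
      have h2 := norm_le_norm_add_norm_sub' (F p w) (F p (w + Complex.log (z / Complex.exp w)))
      have h3 := (hV z hz.1).1
      linarith
    _ ≤ _ := lintegral_mono_set hAI

/-! ### Assembling the theorem -/

/-- Order `i + 1 ≤ k` still enters the norm; this spare derivative is where `j < k` is used. -/
theorem norm_iteratedDeriv_succ_le {s : ℝ} (hs0 : 0 < s) (hs1 : s < 1) {k : ℕ} {f : ℂ → ℂ}
    (hf : f ∈ hardySobolevUnitBall s k) {i : ℕ} (hi : i < k) {z : ℂ} (hz : z ∈ annulus s) :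
    ‖deriv (iteratedDeriv i f) z‖ ≤ s⁻¹ := by
  obtain ⟨hmem, hnorm⟩ := hf
  have h := (Finset.le_sup (f := fun j => linftyCircleNorm s s (iteratedDeriv j f) +
    linftyCircleNorm s 1 (iteratedDeriv j f)) (Finset.mem_range.2 (Nat.succ_lt_succ hi))).trans hnorm
  have hb := (hmem (i + 1) hi).2
  rw [iteratedDeriv_succ] at h hb
  exact norm_deriv_le_of_linftyCircleNorm_le hs0 hs1 (hmem i hi.le).1 hb
    (le_self_add.trans h) (le_add_self.trans h) hz

theorem corollary3p9 (s : ℝ) (hs0 : 0 < s) (hs1 : s < 1) (j k : ℕ) (hjk : j < k)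
    (I : Set ℂ) (hI : IsOpenBoundaryArc s I)
    (f : ℕ → ℂ → ℂ) (hf : ∀ p, f p ∈ hardySobolevUnitBall s k)
    (hL1 : Tendsto (fun p => l1ArcNorm s I (f p)) atTop (𝓝 0)) :
    Tendsto (fun p => hardySobolevNorm s j (f p)) atTop (𝓝 0) := by
  have hlog : Real.log s < 0 := Real.log_neg hs0 hs1
  set K : NNReal := lipschitzExtensionConstant ℂ * s⁻¹.toNNReal with hK
  have hlift : ∀ i, i < k → ∀ p, ∃ F, LipschitzWith K F ∧ IsStripLift s (iteratedDeriv i (f p)) F :=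
    fun i hi p => exists_lipschitzWith_isStripLift hs0 ((hf p).1 i hi.le).1 fun z hz =>
      (norm_iteratedDeriv_succ_le hs0 hs1 (hf p) hi hz).trans (Real.le_coe_toNNReal _)
  choose! F hFK hF using hlift
  set S : Set ℂ := Complex.re ⁻¹' Set.Ioo (Real.log s) 0 with hS
  have hSo : IsOpen S := isOpen_Ioo.preimage Complex.continuous_re
  have hder : ∀ i < k, ∀ p, ∀ w ∈ S, HasDerivAt (F i p)
      (iteratedDeriv (i + 1) (f p) (Complex.exp w) * Complex.exp w) w := fun i hi p w hw => by
    rw [iteratedDeriv_succ]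
    exact (hF i hi p).hasDerivAt hs0 ((hf p).1 i hi.le).1 hw.1 hw.2
  have hinside : ∀ i < k, ∀ w ∈ S, Tendsto (fun p => F i p w) atTop (𝓝 0) := by
    intro i
    induction i with
    | zero =>
      intro hk w hw
      obtain ⟨⟨⟨z, hz⟩, -⟩, U, hU, rfl⟩ := hI
      have hz0 : z ≠ 0 := by
        rintro rfl
        rcases hz.2 with h | h
        · rw [mem_sphere_zero_iff_norm, norm_zero] at h; exact hs0.ne h
        · rw [mem_sphere_zero_iff_norm, norm_zero] at h; exact zero_ne_one h
      have hc : (Complex.log z).re = Real.log s ∨ (Complex.log z).re = 0 := by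
        rw [Complex.log_re]
        rcases hz.2 with h | h
        · rw [mem_sphere_zero_iff_norm.1 h]; exact Or.inl rfl
        · rw [mem_sphere_zero_iff_norm.1 h]; exact Or.inr Real.log_one
      have hev : ∀ᶠ t : ℝ in 𝓝 (Complex.log z).im,
          Complex.exp ((Complex.log z).re + t * Complex.I) ∈ U := by
        have hcont : Continuous fun t : ℝ => Complex.exp ((Complex.log z).re + t * Complex.I) := by
          fun_prop
        refine hcont.continuousAt.eventually_mem (hU.mem_nhds ?_)
        rw [Complex.re_add_im, Complex.exp_log hz0]
        exact hz.1
      obtain ⟨δ, hδ, hseg⟩ := Metric.eventually_nhds_iff.1 hev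
      refine tendsto_zero_of_boundary_segment (t₀ := (Complex.log z).im) (hFK 0 hk) hlog hc hδ
        (fun p w h1 h2 => (hder 0 hk p w ⟨h1, h2⟩).differentiableAt) (fun t ht => ?_) hw.1.le hw.2.le
      refine tendsto_zero_of_tendsto_l1ArcNorm hs0 hs1 hU (fun p => ?_) (hFK 0 hk) hL1
        (by simpa using hc) (hseg ht)
      simpa only [iteratedDeriv_zero] using hF 0 hk p
    | succ i ih =>
      intro hi w hw
      have hi' : i < k := Nat.lt_of_succ_lt hi
      -- In the strip the derivative of the `i`-th lift, divided by `exp w`, is the next lift.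
      have h := (tendsto_deriv_zero (hFK i hi') hSo
        (fun p v hv => (hder i hi' p v hv).differentiableAt.differentiableWithinAt) (ih hi') hw).div_const
        (Complex.exp w)
      rw [zero_div] at h
      refine h.congr fun p => ?_
      rw [(hder i hi' p w hw).deriv, mul_div_cancel_right₀ _ (Complex.exp_ne_zero w),
        hF (i + 1) hi p w hw.1 hw.2]
  have hcirc : ∀ i < k, ∀ r, (r = s ∨ r = 1) →
      Tendsto (fun p => linftyCircleNorm s r (iteratedDeriv i (f p))) atTop (𝓝 0) := by
    intro i hi r hr
    have hr0 : 0 < r := by rcases hr with rfl | rfl <;> linarith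
    rw [ENNReal.tendsto_nhds_zero]
    intro ε hε
    obtain ⟨e, he0, he⟩ := ENNReal.lt_iff_exists_nnreal_btwn.1 hε
    -- The principal logarithm sends both circles into this rectangle, so one period suffices.
    have hR : IsCompact (Set.Icc (Real.log s) 0 ×ℂ Set.Icc (-Real.pi) Real.pi) :=
      isCompact_Icc.reProdIm isCompact_Icc
    filter_upwards [eventually_norm_le_of_isCompact (hFK i hi) hR (fun w hw =>
      tendsto_zero_of_mem_closure (hFK i hi) (hinside i hi) (by
        rw [hS, Complex.closure_preimage_re, closure_Ioo hlog.ne]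
        exact hw.1)) (ε := e) (by exact_mod_cast he0)] with p hp
    refine (linftyCircleNorm_le hr0.le (ε := e) fun z hz => ?_).trans (by simpa using he.le)
    rw [mem_sphere_zero_iff_norm] at hz
    have hre : (Complex.log z).re = Real.log s ∨ (Complex.log z).re = 0 := by
      rw [Complex.log_re, hz]
      rcases hr with rfl | rfl
      · exact Or.inl rfl
      · exact Or.inr Real.log_one
    have hb := (hF i hi p).boundaryValue_exp hs0 hs1 (hFK i hi p).continuous hre
    rw [Complex.exp_log (norm_pos_iff.1 (hz ▸ hr0))] at hb
    rw [hb]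
    refine hp _ ⟨?_, ?_⟩
    · rcases hre with h | h
      · exact ⟨h.ge, h.trans_le hlog.le⟩
      · exact ⟨hlog.le.trans h.ge, h.le⟩
    · rw [Set.mem_preimage, Complex.log_im]
      exact ⟨(Complex.neg_pi_lt_arg z).le, Complex.arg_le_pi z⟩
  rw [ENNReal.tendsto_nhds_zero]
  intro ε hε
  have hall : ∀ i ∈ Finset.range (j + 1), ∀ᶠ p in atTop,
      linftyCircleNorm s s (iteratedDeriv i (f p)) + linftyCircleNorm s 1 (iteratedDeriv i (f p)) ≤
        ε := by
    intro i hi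
    have hik : i < k := (Nat.lt_succ_iff.1 (Finset.mem_range.1 hi)).trans_lt hjk
    have := (hcirc i hik s (Or.inl rfl)).add (hcirc i hik 1 (Or.inr rfl))
    rw [add_zero] at this
    exact ENNReal.tendsto_nhds_zero.1 this ε hε
  filter_upwards [(Finset.eventually_all _).2 hall] with p hp
  exact Finset.sup_le hp
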